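/- Let $p$ be a prime, let $K/\mathbb{Q}_p$ be a finite extension with algebraic closure $\overline{K}$, and let $|\cdot|$ be the absolute value on $K$ extending the $p$-adic absolute value. Let $f(z)=\sum_{i=0}^d a_iz^i\in K[z]$ be a monic polynomial of degree $d$ with $p\nmid d$, and suppose that $f$ has good reduction, i.e. $|a_i|\le 1$ for all $i$. Let $P\in K$ be a point outside the filled Julia set of $f$, i.e. such that the forward orbit $\{f^N(P): N\ge 0\}$ is an unbounded subset of $K$ (here $f^N$ is the $N$-th iterate of $f$). Let $T$ be the rooted tree of iterated preimages of $P$: the nodes at level $N\geq 0$ are the $x\in\overline{K}$ with $f^N(x)=P$, and the node below a node $x$ at level $N+1$ is the node $f(x)$ at level $N$. Let $\operatorname{Aut}(T)$ be the group of automorphisms of this rooted tree, and let $\rho_{f,P}:\operatorname{Gal}(\overline{K}/K)\to\operatorname{Aut}(T)$ be the arboreal Galois representation, given by the action of the Galois group on the nodes. A *consistent labelling* of $T$ is a labelling, for each $N\geq 0$, of the nodes at level $N$ as $\alpha_k$ with $k\in\mathbb{Z}/d^N\mathbb{Z}$ (each node receiving exactly one label and each label being used exactly once), such that for $N\geq 1$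 the node below $\alpha_k$ is labelled by the image of $k$ under the natural map $\mathbb{Z}/d^N\mathbb{Z}\to\mathbb{Z}/d^{N-1}\mathbb{Z}$. A *Kummer subgroup* of $\operatorname{Aut}(T)$ is a subgroup $G$ for which there is a consistent labelling of $T$ such that, for every $N$, the restriction of $G$ to the nodes at level $N$ is isomorphic to $(\mathbb{Z}/d^N\mathbb{Z})\rtimes(\mathbb{Z}/d^N\mathbb{Z})^\times$, acting by $(i,j)\alpha_k=\alpha_{jk+i}$. Then there is a Kummer subgroup $G$ of $\operatorname{Aut}(T)$ such that the image of $\rho_{f,P}$ is contained in $G$ and has finite index in $G$. -/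

import Mathlib

/-- A rooted tree, given by its levels: `node N` is the set of nodes at distance `N` from the root,
there is exactly one node at level `0`, and every node at level `N + 1` is joined to
exactly one node `parent N x` at level `N`. -/
structure LevelledTree where
  node : ℕ → Type*
  root : Unique (node 0)
  parent : ∀ N, node (N + 1) → node N

namespace LevelledTree

/-- The group `Aut(T)` of automorphisms of a rooted tree: families of permutations of the levels
that are compatible with the edges of the tree. -/
def Aut (T : LevelledTree) : Subgroup (∀ N, Equiv.Perm (T.node N)) where
  carrier := {g | ∀ N (x : T.node (N + 1)), T.parent N (g (N + 1) x) = g N (T.parent N x)}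
  mul_mem' := by
    intro g h hg hh N x
    simp only [Set.mem_ofPred_eq] at hg hh
    simp [hg, hh]
  one_mem' := by
    intro N x
    simp
  inv_mem' := by
    intro g hg N x
    have h := hg N ((g (N + 1)).symm x)
    rw [Equiv.apply_symm_apply] at h
    change T.parent N ((g (N + 1)).symm x) = (g N).symm (T.parent N x)
    rw [h, Equiv.symm_apply_apply]

/-- The restriction of tree automorphisms to the nodes at level `N`. -/
def restrict (T : LevelledTree) (N : ℕ) : T.Aut →* Equiv.Perm (T.node N) :=
  (Pi.evalMonoidHom (fun N => Equiv.Perm (T.node N)) N).comp T.Aut.subtype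

/-- A consistent labelling of `T`: for every `N`, the nodes at level `N` are labelled bijectively
as `α N k` with `k ∈ ℤ/d^N`, and the node below `α (N + 1) k` is the one that is labelled by the
image of `k` under the natural map `ℤ/d^(N+1) → ℤ/d^N`. -/
structure ConsistentLabelling (T : LevelledTree) (d : ℕ) where
  α : ∀ N, ZMod (d ^ N) ≃ T.node N
  parent_α : ∀ N (k : ZMod (d ^ (N + 1))),
    T.parent N (α (N + 1) k) =
      α N (ZMod.castHom (pow_dvd_pow d (Nat.le_succ N)) (ZMod (d ^ N)) k)

end LevelledTree

/-- The action of `(ℤ/n)ˣ` on the additive group `ℤ/n` by multiplication. -/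
def unitsAction (n : ℕ) : (ZMod n)ˣ →* MulAut (Multiplicative (ZMod n)) :=
  (MulAutMultiplicative (ZMod n)).symm.toMonoidHom.comp
    (DistribMulAction.toAddAut (ZMod n)ˣ (ZMod n))

/-- The semidirect product `(ℤ/n) ⋊ (ℤ/n)ˣ`. -/
abbrev AffineZMod (n : ℕ) : Type := Multiplicative (ZMod n) ⋊[unitsAction n] (ZMod n)ˣ

/-- A Kummer subgroup of `Aut(T)`: for some consistent labelling of `T`, the restriction of `G` to
the nodes at each level `N` is isomorphic to `(ℤ/d^N) ⋊ (ℤ/d^N)ˣ`, acting by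
`(i, j) α_k = α_{j k + i}`. -/
def LevelledTree.IsKummerSubgroup (T : LevelledTree) (d : ℕ) (G : Subgroup T.Aut) : Prop :=
  ∃ L : T.ConsistentLabelling d, ∀ N : ℕ,
    ∃ e : AffineZMod (d ^ N) ≃* G.map (T.restrict N),
      ∀ (a : AffineZMod (d ^ N)) (k : ZMod (d ^ N)),
        (e a : Equiv.Perm (T.node N)) (L.α N k) =
          L.α N ((a.right : ZMod (d ^ N)) * k + Multiplicative.toAdd a.left)

section Preimages

variable {K : Type*} [Field K]

/-- The tree `T` of iterated preimages of `P` under `f`: the nodes at level `N` are the `x` in the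
algebraic closure of `K` such that `f^N(x) = P`, and `x` at level `N + 1` is joined to `f(x)`. -/
noncomputable def preimageTree (f : Polynomial K) (P : K) : LevelledTree where
  node N := {x : AlgebraicClosure K //
    (fun z => Polynomial.aeval z f)^[N] x = algebraMap K (AlgebraicClosure K) P}
  root :=
    { default := ⟨algebraMap K (AlgebraicClosure K) P, Function.iterate_zero_apply _ _⟩
      uniq := fun x => Subtype.ext ((Function.iterate_zero_apply _ _).symm.trans x.2) }
  parent _ x := ⟨Polynomial.aeval x.1 f, (Function.iterate_succ_apply _ _ _).symm.trans x.2⟩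

/-- Elements of the Galois group commute with the iterates of `f`. -/
theorem galois_iterate (f : Polynomial K) (σ : Gal(AlgebraicClosure K/K)) (N : ℕ)
    (x : AlgebraicClosure K) :
    (fun z => Polynomial.aeval z f)^[N] (σ x) = σ ((fun z => Polynomial.aeval z f)^[N] x) := by
  induction N generalizing x with
  | zero => simp only [Function.iterate_zero_apply]
  | succ N ih =>
    simp only [Function.iterate_succ, Function.comp_apply]
    rw [← ih]
    exact congrArg _ (Polynomial.aeval_algHom_apply σ x f)

/-- The permutation of the nodes at level `N` induced by an element of the Galois group. -/
noncomputable def galoisPerm (f : Polynomial K) (P : K) (N : ℕ)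
    (σ : Gal(AlgebraicClosure K/K)) : Equiv.Perm ((preimageTree f P).node N) :=
  σ.toEquiv.subtypeEquiv fun x => by
    change _ ↔ (fun z => Polynomial.aeval z f)^[N] (σ x) = _
    rw [galois_iterate]
    constructor
    · intro h
      rw [h]
      exact σ.commutes P
    · intro h
      exact σ.injective (h.trans (σ.commutes P).symm)

/-- The arboreal Galois representation `ρ_{f, P} : Gal(K̄/K) → Aut(T)`. -/
noncomputable def arborealRep (f : Polynomial K) (P : K) :
    Gal(AlgebraicClosure K/K) →* (preimageTree f P).Aut where
  toFun σ := ⟨fun N => galoisPerm f P N σ, fun _ x =>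
    Subtype.ext (Polynomial.aeval_algHom_apply σ x.1 f)⟩
  map_one' := Subtype.ext (funext fun _ => Equiv.ext fun _ => Subtype.ext rfl)
  map_mul' _ _ := Subtype.ext (funext fun _ => Equiv.ext fun _ => Subtype.ext rfl)

end Preimages

/-- The filled Julia set of `f`: the elements of `K` whose forward orbit under `f` is bounded. -/
def filledJulia {K : Type*} [NormedField K] (f : Polynomial K) : Set K :=
  {z | Bornology.IsBounded (Set.range fun n : ℕ => (fun w => f.eval w)^[n] z)}

/-- Good reduction of a monic polynomial: all coefficients have absolute value at most `1`. -/
def HasGoodReduction {K : Type*} [NormedField K] (f : Polynomial K) : Prop :=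
  ∀ i : ℕ, ‖f.coeff i‖ ≤ 1

/-! Write `d` for the degree of `f`. Good reduction makes `f` look like `z ^ d` outside the unit
ball: if `|x| > 1`, then `f(x)` and `x ^ d` have the same leading term. As `|P| > 1`, the equation
`f^N(x) = P` is a perturbation of `y ^ (d ^ N) = P`. Since `p ∤ d`, distinct `d ^ N`-th roots of `P`
have distinct leading terms, so each node is near exactly one root
(`exists_consistentLabelling_near`). The Galois group preserves the absolute value, so it permutes
the nodes as it permutes the roots, that is, by affine maps on the labels. `G` is the group of all
tree automorphisms that are affine on labels.

For the finite index, put `n = d ^ N`. The affine group of `ℤ/n` has at most `n ^ 2` elements, so it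
suffices that the image has at least a constant times `n` translations and an element whose linear
part has order at least a constant times `n`. The latter is a Frobenius element: it raises `n`-th
roots of unity to the power `q`, the residue cardinality, and the order of `q` modulo `n` is bounded
below by lifting the exponent (`exists_pow_dvd_mul_orderOf`). If there are `a` translations, then
Kummer theory makes `P ^ (a * (q - 1))` an `n`-th power in `K`
(`exists_pow_eq_pow_card_translations`). The value group is discrete and `|P| > 1`, so `n` divides a
fixed multiple of `a`. The index is thus bounded uniformly in `N`, and the bound passes to the limit
because the image is closed. -/

open Polynomial
open scoped NNReal

/-! ### Affine maps of `ℤ/n` -/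

/-- The action of the semidirect product `(ℤ/n) ⋊ (ℤ/n)ˣ` on `ℤ/n` by affine maps. -/
def affinePerm (n : ℕ) : AffineZMod n →* Equiv.Perm (ZMod n) where
  toFun a :=
    { toFun := fun k => (a.right : ZMod n) * k + Multiplicative.toAdd a.left
      invFun := fun k => ((a.right⁻¹ : (ZMod n)ˣ) : ZMod n) * (k - Multiplicative.toAdd a.left)
      left_inv := fun k => by simp
      right_inv := fun k => by simp }
  map_one' := by ext k; simp
  map_mul' a b := by
    ext k
    have : Multiplicative.toAdd ((unitsAction n a.right) b.left) =
      (a.right : ZMod n) * Multiplicative.toAdd b.left := rfl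
    simp only [Equiv.coe_fn_mk, SemidirectProduct.mul_right, SemidirectProduct.mul_left,
      Units.val_mul, toAdd_mul, this, Equiv.Perm.coe_mul, Function.comp_apply]
    ring

theorem affinePerm_apply {n : ℕ} (a : AffineZMod n) (k : ZMod n) :
    affinePerm n a k = (a.right : ZMod n) * k + Multiplicative.toAdd a.left := rfl

theorem affinePerm_injective (n : ℕ) : Function.Injective (affinePerm n) := by
  intro a b h
  have h0 := DFunLike.congr_fun h 0
  have h1 := DFunLike.congr_fun h 1
  simp only [affinePerm_apply, mul_zero, zero_add, mul_one] at h0 h1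
  rw [h0, add_left_inj] at h1
  exact SemidirectProduct.ext (Multiplicative.toAdd.injective h0) (Units.ext h1)

/-- The affine map `k ↦ j k + i` of `ℤ/n` for natural numbers `i` and `j`. -/
def natAffine (n i j : ℕ) (h : j.Coprime n) : AffineZMod n :=
  ⟨Multiplicative.ofAdd (i : ZMod n), ZMod.unitOfCoprime j h⟩

theorem affinePerm_natAffine (n i j : ℕ) (h : j.Coprime n) (k : ZMod n) :
    affinePerm n (natAffine n i j h) k = j * k + i := rfl

theorem natAffine_val {n : ℕ} [NeZero n] (a : AffineZMod n) :
    natAffine n (Multiplicative.toAdd a.left).val (a.right : ZMod n).val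
      (ZMod.val_coe_unit_coprime a.right) = a := by
  refine SemidirectProduct.ext ?_ (Units.ext ?_)
  · simp [natAffine]
  · simp [natAffine]

theorem AffineZMod.finite (n : ℕ) [NeZero n] : Finite (AffineZMod n) :=
  Finite.of_injective
    (fun a : AffineZMod n => ((Multiplicative.toAdd a.left : ZMod n), a.right))
    (fun _ _ h => SemidirectProduct.ext (congrArg Prod.fst h) (congrArg Prod.snd h))

/-! ### Tree automorphisms that are affine on labels -/

namespace LevelledTree

variable {T : LevelledTree} {d : ℕ}

theorem restrict_apply (N : ℕ) (g : T.Aut) : T.restrict N g = g.1 N := rfl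

namespace ConsistentLabelling

variable (L : T.ConsistentLabelling d)

/-- Affine maps acting on the nodes at level `N` through a labelling. -/
def affine (N : ℕ) : AffineZMod (d ^ N) →* Equiv.Perm (T.node N) :=
  (L.α N).permCongrHom.toMonoidHom.comp (affinePerm (d ^ N))

theorem affine_apply (N : ℕ) (a : AffineZMod (d ^ N)) (k : ZMod (d ^ N)) :
    L.affine N a (L.α N k) = L.α N (affinePerm (d ^ N) a k) := by
  change (L.α N) (affinePerm (d ^ N) a ((L.α N).symm (L.α N k))) = _
  rw [Equiv.symm_apply_apply]

theorem affine_injective (N : ℕ) : Function.Injective (L.affine N) :=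
  (L.α N).permCongrHom.injective.comp (affinePerm_injective _)

theorem eq_affine_iff (N : ℕ) (g : Equiv.Perm (T.node N)) (a : AffineZMod (d ^ N)) :
    g = L.affine N a ↔ ∀ k, g (L.α N k) = L.α N (affinePerm (d ^ N) a k) := by
  constructor
  · rintro rfl k
    exact L.affine_apply N a k
  · intro h
    ext x
    obtain ⟨k, rfl⟩ := (L.α N).surjective x
    rw [h, affine_apply]

/-- The tree automorphism that acts as `k ↦ j k + i` on the labels of all levels. -/
def natAut (i j : ℕ) (h : j.Coprime d) : T.Aut :=
  ⟨fun N => L.affine N (natAffine (d ^ N) i j (h.pow_right N)), fun N x => by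
    obtain ⟨k, rfl⟩ := (L.α (N + 1)).surjective x
    rw [affine_apply, L.parent_α, L.parent_α, affine_apply, affinePerm_natAffine,
      affinePerm_natAffine]
    simp only [map_add, map_mul, map_natCast]⟩

/-- The group of all tree automorphisms that act by affine maps on the labels of each level. -/
def affineGroup : Subgroup T.Aut :=
  ⨅ N, (L.affine N).range.comap (T.restrict N)

theorem mem_affineGroup {g : T.Aut} :
    g ∈ L.affineGroup ↔ ∀ N, ∃ a, L.affine N a = g.1 N := by
  simp [affineGroup, Subgroup.mem_iInf, restrict_apply]

theorem natAut_mem (i j : ℕ) (h : j.Coprime d) : L.natAut i j h ∈ L.affineGroup :=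
  L.mem_affineGroup.2 fun _ => ⟨_, rfl⟩

/-- Natural number representatives of the coefficients define an affine map at every level at once,
so affine maps at one level extend to the whole tree. -/
theorem exists_natAut (hd : d ≠ 0) (N : ℕ) (a : AffineZMod (d ^ N)) :
    ∃ i j, ∃ h : j.Coprime d, (L.natAut i j h).1 N = L.affine N a := by
  have : NeZero (d ^ N) := ⟨pow_ne_zero _ hd⟩
  -- Being a unit modulo `d ^ 0 = 1` says nothing about coprimality to `d`, so level `0` is
  -- separate.
  rcases N.eq_zero_or_pos with rfl | hN
  · refine ⟨0, 1, Nat.coprime_one_left d, Equiv.ext fun x => ?_⟩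
    exact (T.root.uniq _).trans (T.root.uniq _).symm
  · exact ⟨(Multiplicative.toAdd a.left).val, (a.right : ZMod (d ^ N)).val,
      (Nat.coprime_pow_right_iff hN _ _).1 (ZMod.val_coe_unit_coprime a.right),
      congrArg (L.affine N) (natAffine_val a)⟩

theorem map_restrict_affineGroup (hd : d ≠ 0) (N : ℕ) :
    L.affineGroup.map (T.restrict N) = (L.affine N).range := by
  apply le_antisymm
  · rintro _ ⟨g, hg, rfl⟩
    exact L.mem_affineGroup.1 hg N
  · rintro _ ⟨a, rfl⟩
    obtain ⟨i, j, h, e⟩ := L.exists_natAut hd N a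
    exact ⟨_, L.natAut_mem i j h, e⟩

theorem isKummerSubgroup_affineGroup (hd : d ≠ 0) : T.IsKummerSubgroup d L.affineGroup := by
  refine ⟨L, fun N => ⟨((L.affine N).ofInjective (L.affine_injective N)).trans
    (MulEquiv.subgroupCongr (L.map_restrict_affineGroup hd N).symm), fun a k => ?_⟩⟩
  exact L.affine_apply N a k

/-- The affine map by which an element of the affine group acts on level `N`. -/
noncomputable def affinePart (N : ℕ) : L.affineGroup →* AffineZMod (d ^ N) :=
  ((L.affine N).ofInjective (L.affine_injective N)).symm.toMonoidHom.comp
    (((T.restrict N).comp L.affineGroup.subtype).codRestrict (L.affine N).range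
      fun g => L.mem_affineGroup.1 g.2 N)

theorem affine_affinePart (N : ℕ) (g : L.affineGroup) :
    L.affine N (L.affinePart N g) = g.1.1 N :=
  congrArg Subtype.val (((L.affine N).ofInjective (L.affine_injective N)).apply_symm_apply _)

theorem affinePart_eq_iff (N : ℕ) (g h : L.affineGroup) :
    L.affinePart N g = L.affinePart N h ↔ g.1.1 N = h.1.1 N := by
  rw [← affine_affinePart, ← affine_affinePart, (L.affine_injective N).eq_iff]

theorem affinePart_surjective (hd : d ≠ 0) (N : ℕ) : Function.Surjective (L.affinePart N) := by
  intro a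
  obtain ⟨i, j, h, e⟩ := L.exists_natAut hd N a
  refine ⟨⟨_, L.natAut_mem i j h⟩, L.affine_injective N ?_⟩
  rw [affine_affinePart, e]

theorem parent_surjective {T : LevelledTree} {d : ℕ} (L : T.ConsistentLabelling d) (hd : d ≠ 0) (N : ℕ) : Function.Surjective (T.parent N) := by
  intro x
  obtain ⟨k, rfl⟩ := (L.α N).surjective x
  have : NeZero (d ^ N) := ⟨pow_ne_zero _ hd⟩
  refine ⟨L.α (N + 1) (k.val : ZMod (d ^ (N + 1))), ?_⟩
  rw [L.parent_α]
  simp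

end ConsistentLabelling

end LevelledTree

/-! ### From bounded index at all levels to finite index -/

/-- An antitone sequence of subgroups of bounded index has an intersection of finite index. -/
theorem Subgroup.finiteIndex_iInf_of_antitone {G : Type*} [Group G] (H : ℕ → Subgroup G)
    (hH : Antitone H) (C : ℕ) (h0 : ∀ N, (H N).index ≠ 0) (hC : ∀ N, (H N).index ≤ C) :
    (⨅ N, H N).FiniteIndex := by
  obtain ⟨M, hM⟩ : ∃ M, ∀ N, (H N).index ≤ (H M).index := by
    have hb : BddAbove (Set.range fun N => (H N).index) := ⟨C, by rintro _ ⟨N, rfl⟩; exact hC N⟩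
    obtain ⟨M, hM⟩ := Nat.sSup_mem (Set.range_nonempty fun N => (H N).index) hb
    refine ⟨M, fun N => ?_⟩
    change _ = sSup _ at hM
    simp only at hM
    rw [hM]
    exact le_csSup hb ⟨N, rfl⟩
  -- Below `H M` the index can only grow, but it is already maximal, so the sequence is constant
  -- from `M` on.
  have key : ∀ N, H M ≤ H N := by
    intro N
    rcases le_total N M with h | h
    · exact hH h
    · have h1 := Subgroup.relIndex_mul_index (hH h)
      have h2 := hM N
      rw [← Subgroup.relIndex_eq_one]
      have h3 : 0 < (H M).index := Nat.pos_of_ne_zero (h0 M)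
      have h4 : (H N).relIndex (H M) ≠ 0 := fun h => h0 N (by rw [← h1, h, zero_mul])
      nlinarith [Nat.pos_of_ne_zero h4]
  have : (⨅ N, H N) = H M := le_antisymm (iInf_le _ M) (le_iInf key)
  rw [this]
  exact ⟨h0 M⟩

/-- A closed `H` is the intersection of the preimages of its images at finite levels. These
preimages decrease with the level and have the same index as the images. -/
theorem LevelledTree.ConsistentLabelling.finiteIndex_subgroupOf_affineGroup {T : LevelledTree}
    {d : ℕ} (L : T.ConsistentLabelling d) (hd : d ≠ 0) (H : Subgroup T.Aut)
    (hclosed : ∀ g : T.Aut, (∀ N, ∃ h ∈ H, h.1 N = g.1 N) → g ∈ H) (C : ℕ)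
    (hC : ∀ N, ((H.subgroupOf L.affineGroup).map (L.affinePart N)).index ≤ C) :
    (H.subgroupOf L.affineGroup).FiniteIndex := by
  set S : ℕ → Subgroup L.affineGroup := fun N =>
    ((H.subgroupOf L.affineGroup).map (L.affinePart N)).comap (L.affinePart N) with hS
  have hidx : ∀ N, (S N).index = ((H.subgroupOf L.affineGroup).map (L.affinePart N)).index :=
    fun N => Subgroup.index_comap_of_surjective _ (L.affinePart_surjective hd N)
  have hmem : ∀ N (g : L.affineGroup), g ∈ S N ↔ ∃ h : L.affineGroup, h.1 ∈ H ∧ h.1.1 N = g.1.1 N := by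
    intro N g
    simp only [hS, Subgroup.mem_comap, Subgroup.mem_map, Subgroup.mem_subgroupOf,
      L.affinePart_eq_iff]
  have hle : (⨅ N, S N) ≤ H.subgroupOf L.affineGroup := by
    intro g hg
    rw [Subgroup.mem_iInf] at hg
    rw [Subgroup.mem_subgroupOf]
    refine hclosed _ fun N => ?_
    obtain ⟨h, h1, h2⟩ := (hmem N g).1 (hg N)
    exact ⟨h.1, h1, h2⟩
  have : (⨅ N, S N).FiniteIndex := by
    apply Subgroup.finiteIndex_iInf_of_antitone S _ C
    · intro N
      have : NeZero (d ^ N) := ⟨pow_ne_zero _ hd⟩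
      have := AffineZMod.finite (d ^ N)
      rw [hidx]
      exact Subgroup.index_ne_zero_of_finite
    · intro N
      rw [hidx]
      exact hC N
    · refine antitone_nat_of_succ_le fun N g hg => ?_
      rw [hmem] at hg ⊢
      obtain ⟨h, h1, h2⟩ := hg
      refine ⟨h, h1, Equiv.ext fun x => ?_⟩
      obtain ⟨y, rfl⟩ := L.parent_surjective hd N x
      rw [← h.1.2, ← g.1.2, h2]
  exact Subgroup.finiteIndex_of_le hle

/-! ### Lifting the exponent: the order of `q` modulo `d ^ N` -/

/-- If `u ≡ 1` modulo `d ^ 2` and `d ^ N` divides `u ^ k - 1`, then `d ^ N` divides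
`(u - 1) * k`. -/
theorem pow_dvd_sub_one_mul_of_pow_dvd_pow_sub_one {d u N k : ℕ} (hu : 1 ≤ u)
    (hd : d ^ 2 ∣ u - 1) (h : d ^ N ∣ u ^ k - 1) : d ^ N ∣ (u - 1) * k := by
  rw [Nat.dvd_iff_prime_pow_dvd_dvd]
  intro l m hl hm
  rcases Nat.eq_zero_or_pos m with rfl | hmpos
  · simp
  have hld : l ∣ d := hl.dvd_of_dvd_pow ((dvd_pow_self l hmpos.ne').trans hm)
  have hlu : l ^ 2 ∣ u - 1 := (pow_dvd_pow_of_dvd hld 2).trans hd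
  have hlu1 : l ∣ u - 1 := (dvd_pow_self l two_ne_zero).trans hlu
  have hnl : ¬ l ∣ u := fun h' => hl.one_lt.ne' (Nat.dvd_one.1 (by
    have := Nat.dvd_sub h' hlu1
    rwa [Nat.sub_sub_self hu] at this))
  have hz : ((u - 1 : ℕ) : ℤ) = (u : ℤ) - 1 := by push_cast [hu]; ring
  have hzk : ((u ^ k - 1 : ℕ) : ℤ) = (u : ℤ) ^ k - 1 ^ k := by
    push_cast [Nat.one_le_pow k u hu]; ring
  have key : emultiplicity (l : ℤ) ((u : ℤ) ^ k - 1 ^ k) =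
      emultiplicity (l : ℤ) ((u : ℤ) - 1) + emultiplicity (l : ℤ) (k : ℤ) := by
    -- Lifting the exponent at the prime `2` needs `u ≡ 1` modulo `4`; this is why the hypothesis
    -- involves `d ^ 2`.
    rcases hl.eq_two_or_odd' with rfl | hodd
    · refine Int.two_pow_sub_pow' k ?_ (by exact_mod_cast hnl)
      rw [← hz]
      exact_mod_cast hlu
    · rw [Int.emultiplicity_pow_sub_pow hl hodd (by rw [← hz]; exact_mod_cast hlu1)
        (by exact_mod_cast hnl), Int.natCast_emultiplicity]
  have hlm : (l : ℤ) ^ m ∣ (u : ℤ) ^ k - 1 ^ k := by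
    rw [← hzk]; exact_mod_cast hm.trans h
  rw [pow_dvd_iff_le_emultiplicity, key, ← emultiplicity_mul (Nat.prime_iff_prime_int.1 hl),
    ← pow_dvd_iff_le_emultiplicity, ← hz] at hlm
  exact_mod_cast hlm

/-- The order of a fixed natural number `q` modulo `d ^ N` is at least a constant times `d ^ N`. -/
theorem exists_pow_dvd_mul_orderOf {d q : ℕ} (hd : d ≠ 0) (hq : 2 ≤ q) (hqd : q.Coprime d) :
    ∃ c ≠ 0, ∀ N (x : (ZMod (d ^ N))ˣ), (x : ZMod (d ^ N)) = q → d ^ N ∣ c * orderOf x := by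
  -- By Euler's theorem `u = q ^ φ(d ^ 2)` is `1` modulo `d ^ 2`, and `u - 1` serves as the
  -- constant.
  have hM : 0 < (d ^ 2).totient := Nat.totient_pos.2 (by positivity)
  set u := q ^ (d ^ 2).totient with hu
  have hu1 : 1 < u := Nat.one_lt_pow hM.ne' hq
  refine ⟨u - 1, by omega, fun N x hx => ?_⟩
  refine pow_dvd_sub_one_mul_of_pow_dvd_pow_sub_one hu1.le ?_ ?_
  · exact (Nat.modEq_iff_dvd' hu1.le).1 (Nat.ModEq.pow_totient (hqd.pow_right 2)).symm
  · refine (Nat.modEq_iff_dvd' (Nat.one_le_pow _ _ (by omega))).1 ?_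
    rw [← ZMod.natCast_eq_natCast_iff, hu, ← pow_mul, mul_comm, pow_mul]
    have h1 : (q : ZMod (d ^ N)) ^ orderOf x = 1 := by
      rw [← hx, ← Units.val_pow_eq_pow_val, pow_orderOf_eq_one, Units.val_one]
    push_cast
    rw [h1, one_pow]

/-! ### Index of a subgroup of the affine group -/

theorem AffineZMod.card_le (n : ℕ) [NeZero n] : Nat.card (AffineZMod n) ≤ n * n := by
  have : Nat.card (AffineZMod n) ≤ Nat.card (ZMod n × ZMod n) :=
    Nat.card_le_card_of_injective
      (fun a : AffineZMod n => ((Multiplicative.toAdd a.left : ZMod n), (a.right : ZMod n)))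
      (fun _ _ h => SemidirectProduct.ext (congrArg Prod.fst h)
        (Units.ext (congrArg Prod.snd h)))
  simpa using this

/-- The translations in a subgroup of the affine group of `ℤ/n`. -/
def translations {n : ℕ} (Γ : Subgroup (AffineZMod n)) : AddSubgroup (ZMod n) :=
  Subgroup.toAddSubgroup' (Γ.comap SemidirectProduct.inl)

theorem mem_translations {n : ℕ} {Γ : Subgroup (AffineZMod n)} {s : ZMod n} :
    s ∈ translations Γ ↔ SemidirectProduct.inl (Multiplicative.ofAdd s) ∈ Γ := Iff.rfl

theorem AffineZMod.toAdd_mul_left {n : ℕ} (a b : AffineZMod n) :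
    (Multiplicative.toAdd (a * b).left : ZMod n) =
      Multiplicative.toAdd a.left + (a.right : ZMod n) * Multiplicative.toAdd b.left := rfl

/-- Linear parts commute, so the commutator of `a` and `b` is a translation; the expression is its
amount. -/
theorem commutator_mem_translations {n : ℕ} {Γ : Subgroup (AffineZMod n)} {a b : AffineZMod n}
    (ha : a ∈ Γ) (hb : b ∈ Γ) :
    ((a.right : ZMod n) - 1) * Multiplicative.toAdd b.left -
      ((b.right : ZMod n) - 1) * Multiplicative.toAdd a.left ∈ translations Γ := by
  rw [mem_translations]
  have : a * b = SemidirectProduct.inl (Multiplicative.ofAdd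
      (((a.right : ZMod n) - 1) * Multiplicative.toAdd b.left -
      ((b.right : ZMod n) - 1) * Multiplicative.toAdd a.left)) * (b * a) := by
    refine SemidirectProduct.ext (Multiplicative.toAdd.injective ?_) ?_
    · simp only [AffineZMod.toAdd_mul_left, SemidirectProduct.left_inl,
        SemidirectProduct.right_inl, toAdd_ofAdd, Units.val_one]
      ring
    · rw [SemidirectProduct.mul_right, SemidirectProduct.mul_right, SemidirectProduct.mul_right,
        SemidirectProduct.right_inl, one_mul, mul_comm]
  rw [← mul_inv_eq_iff_eq_mul] at this
  rw [← this]
  exact Γ.mul_mem (Γ.mul_mem ha hb) (Γ.inv_mem (Γ.mul_mem hb ha))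

/-- The products of a translation and a power of `a` below the order of its linear part are
distinct: the linear part determines the exponent. -/
theorem AffineZMod.card_translations_mul_orderOf_le {n : ℕ} [NeZero n]
    {Γ : Subgroup (AffineZMod n)} {a : AffineZMod n} (ha : a ∈ Γ) :
    Nat.card (translations Γ) * orderOf a.right ≤ Nat.card Γ := by
  have := AffineZMod.finite n
  have h : Nat.card (translations Γ × Fin (orderOf a.right)) ≤ Nat.card Γ := by
    refine Nat.card_le_card_of_injective
      (fun x => (⟨SemidirectProduct.inl (Multiplicative.ofAdd x.1.1) * a ^ x.2.1,
        Γ.mul_mem (mem_translations.1 x.1.2) (Γ.pow_mem ha _)⟩ : Γ)) ?_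
    rintro ⟨⟨s, hs⟩, k, hk⟩ ⟨⟨t, ht⟩, l, hl⟩ h
    simp only [Subtype.mk.injEq] at h
    have hr := congrArg SemidirectProduct.rightHom h
    simp only [map_mul, map_pow, SemidirectProduct.rightHom_inl, one_mul,
      SemidirectProduct.rightHom_eq_right] at hr
    obtain rfl : k = l := pow_injOn_Iio_orderOf hk hl hr
    have := SemidirectProduct.inl_injective (mul_right_cancel h)
    simp only [Prod.mk.injEq, Subtype.mk.injEq, and_true]
    exact Multiplicative.ofAdd.injective this
  simpa using h

/-- A subgroup of the affine group of `ℤ/n` has bounded index as soon as it contains many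
translations and an element whose linear part has a large order. -/
theorem AffineZMod.index_le {n : ℕ} [NeZero n] {Γ : Subgroup (AffineZMod n)} {a : AffineZMod n}
    (ha : a ∈ Γ) {c₁ c₂ : ℕ} (h₁ : c₁ ≠ 0) (h₂ : c₂ ≠ 0) (hc₁ : n ∣ c₁ * Nat.card (translations Γ))
    (hc₂ : n ∣ c₂ * orderOf a.right) : Γ.index ≤ c₁ * c₂ := by
  have := AffineZMod.finite n
  have hΓ : 0 < Nat.card Γ := Nat.card_pos
  refine Nat.le_of_mul_le_mul_right ?_ hΓ
  rw [Γ.index_mul_card]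
  have ht : 0 < Nat.card (translations Γ) := Nat.card_pos
  calc Nat.card (AffineZMod n) ≤ n * n := AffineZMod.card_le n
    _ ≤ (c₁ * Nat.card (translations Γ)) * (c₂ * orderOf a.right) :=
      Nat.mul_le_mul (Nat.le_of_dvd (by positivity) hc₁)
        (Nat.le_of_dvd (Nat.mul_pos (Nat.pos_of_ne_zero h₂) (orderOf_pos _)) hc₂)
    _ = c₁ * c₂ * (Nat.card (translations Γ) * orderOf a.right) := by ring
    _ ≤ c₁ * c₂ * Nat.card Γ :=
      Nat.mul_le_mul_left _ (AffineZMod.card_translations_mul_orderOf_le ha)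

/-! ### Kummer theory for the roots of `P` -/

/-- The point with label `k` among the points `ζ ^ k * β`. -/
def kummerRoot {Ω : Type*} [Field Ω] (n : ℕ) (ζ β : Ω) (k : ZMod n) : Ω := ζ ^ k.val * β

theorem kummerRoot_pow {Ω : Type*} [Field Ω] {n : ℕ} {ζ β : Ω} (hζ : IsPrimitiveRoot ζ n) (k : ZMod n) :
    kummerRoot n ζ β k ^ n = β ^ n := by
  rw [kummerRoot, mul_pow, pow_right_comm, hζ.pow_eq_one, one_pow, one_mul]

theorem map_radical_eq {Ω : Type*} [Field Ω] {n : ℕ} {ζ β : Ω} {F : Type*} [FunLike F Ω Ω] {σ : F} {a : AffineZMod n}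
    (ha : ∀ k, σ (kummerRoot n ζ β k) = kummerRoot n ζ β (affinePerm n a k)) :
    σ β = ζ ^ (Multiplicative.toAdd a.left : ZMod n).val * β := by
  have := ha 0
  rwa [affinePerm_apply, mul_zero, zero_add, kummerRoot, ZMod.val_zero, pow_zero,
    one_mul] at this

section KummerRoot

variable {Ω : Type*} [Field Ω] {n : ℕ} [NeZero n] {ζ β : Ω}

theorem IsPrimitiveRoot.pow_eq_pow_iff_natCast_eq (hζ : IsPrimitiveRoot ζ n) {k l : ℕ} :
    ζ ^ k = ζ ^ l ↔ (k : ZMod n) = l := by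
  obtain ⟨u, rfl⟩ := hζ.isUnit (NeZero.ne n)
  rw [ZMod.natCast_eq_natCast_iff, ← Units.val_pow_eq_pow_val, ← Units.val_pow_eq_pow_val,
    Units.val_inj, pow_eq_pow_iff_modEq, ← (IsPrimitiveRoot.coe_units_iff.1 hζ).eq_orderOf]

theorem kummerRoot_natCast (hζ : IsPrimitiveRoot ζ n) (k : ℕ) :
    kummerRoot n ζ β k = ζ ^ k * β := by
  rw [kummerRoot, hζ.pow_eq_pow_iff_natCast_eq.2 (ZMod.natCast_zmod_val (k : ZMod n))]

theorem kummerRoot_injective (hζ : IsPrimitiveRoot ζ n) (hβ : β ≠ 0) :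
    Function.Injective (kummerRoot n ζ β) := by
  intro k l h
  simpa using hζ.pow_eq_pow_iff_natCast_eq.1 (mul_right_cancel₀ hβ h)

theorem exists_map_kummerRoot_eq {σ : Ω →+* Ω} (hζ : IsPrimitiveRoot ζ n) (hβ : β ≠ 0)
    (hσ : σ (β ^ n) = β ^ n) :
    ∃ a : AffineZMod n, ∀ k, σ (kummerRoot n ζ β k) = kummerRoot n ζ β (affinePerm n a k) := by
  obtain ⟨j, -, hj, hjζ⟩ := hζ.isPrimitiveRoot_iff.1 (hζ.map_of_injective σ.injective)
  obtain ⟨i, -, hi⟩ := hζ.eq_pow_of_pow_eq_one (ξ := σ β / β) (by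
    rw [div_pow, ← map_pow, hσ, div_self (pow_ne_zero _ hβ)])
  refine ⟨natAffine n i j hj, fun k => ?_⟩
  have : affinePerm n (natAffine n i j hj) k = ((j * k.val + i : ℕ) : ZMod n) := by
    simp [affinePerm_natAffine]
  rw [this, kummerRoot_natCast hζ, kummerRoot, map_mul, map_pow, ← hjζ, pow_add, pow_mul, hi]
  field_simp

theorem map_root_of_unity_eq_pow {F : Type*} [FunLike F Ω Ω] [MonoidHomClass F Ω Ω] {σ : F}
    (hζ : IsPrimitiveRoot ζ n) (hβ : β ≠ 0) {a : AffineZMod n}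
    (ha : ∀ k, σ (kummerRoot n ζ β k) = kummerRoot n ζ β (affinePerm n a k)) :
    σ ζ = ζ ^ (a.right : ZMod n).val := by
  have := ha ((1 : ℕ) : ZMod n)
  have h2 : affinePerm n a ((1 : ℕ) : ZMod n) = (((a.right : ZMod n).val +
      (Multiplicative.toAdd a.left : ZMod n).val : ℕ) : ZMod n) := by
    simp [affinePerm_apply]
  rw [h2, kummerRoot_natCast hζ, kummerRoot_natCast hζ, pow_one, map_mul, map_radical_eq ha,
    pow_add, mul_assoc] at this
  exact mul_right_cancel₀ (mul_ne_zero (pow_ne_zero _ (hζ.ne_zero (NeZero.ne n))) hβ) this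

/-- Kummer theory: if the Galois group acts on the `n`-th roots of `P` through a group of affine
maps with `a` translations, and some element raises the `n`-th roots of unity to the power `q`,
then `P ^ (a * (q - 1))` is an `n`-th power. -/
theorem exists_pow_eq_pow_card_translations {K : Type*} [Field K] [Algebra K Ω] [IsGalois K Ω]
    (hζ : IsPrimitiveRoot ζ n) (hβ : β ≠ 0) {P : K} (hP : β ^ n = algebraMap K Ω P)
    (r : Gal(Ω/K) →* AffineZMod n)
    (hr : ∀ (σ : Gal(Ω/K)) k,
      σ (kummerRoot n ζ β k) = kummerRoot n ζ β (affinePerm n (r σ) k))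
    {σ₀ : Gal(Ω/K)} {q : ℕ} (hq : 1 ≤ q) (hσ₀ : ((r σ₀).right : ZMod n) = q) :
    ∃ γ : K, γ ^ n = P ^ (Nat.card (translations r.range) * (q - 1)) := by
  set a := Nat.card (translations r.range) with ha
  have hβσ := fun σ : Gal(Ω/K) => map_radical_eq (hr σ)
  have hζσ := fun σ : Gal(Ω/K) => map_root_of_unity_eq_pow hζ hβ (hr σ)
  set s₀ : ZMod n := Multiplicative.toAdd (r σ₀).left with hs₀
  -- If `σ β = ζ ^ s * β` and `σ ζ = ζ ^ j`, then `β ^ (a * (q - 1)) * ζ ^ t` is fixed by `σ` when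
  -- `a (q - 1) s + (j - 1) t = 0`. With `t = -a s₀` the left side is `a` times the translation
  -- given by the commutator of `σ₀` and `σ`, which vanishes as `a` is the order of the translation
  -- group.
  set t : ℕ := (-(a * s₀) : ZMod n).val with ht
  have htc : (t : ZMod n) = -(a * s₀) := by simp [ht]
  have hfix : ∀ σ : Gal(Ω/K), σ (β ^ (a * (q - 1)) * ζ ^ t) = β ^ (a * (q - 1)) * ζ ^ t := by
    intro σ
    rw [map_mul, map_pow, map_pow, hβσ, hζσ, mul_pow, ← pow_mul, ← pow_mul, mul_right_comm,
      ← pow_add, mul_comm]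
    congr 1
    rw [hζ.pow_eq_pow_iff_natCast_eq]
    have hc := commutator_mem_translations (Γ := r.range) ⟨σ₀, rfl⟩ ⟨σ, rfl⟩
    have hc' : (a : ZMod n) * (((r σ₀).right - 1 : ZMod n) * Multiplicative.toAdd (r σ).left -
      ((r σ).right - 1 : ZMod n) * Multiplicative.toAdd (r σ₀).left) = 0 := by
      have := congrArg Subtype.val (card_nsmul_eq_zero' (x := (⟨_, hc⟩ : translations r.range)))
      rw [← ha] at this
      rw [← nsmul_eq_mul]
      exact this
    rw [hσ₀, ← hs₀] at hc'
    push_cast [hq, htc]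
    simp only [ZMod.natCast_val, ZMod.cast_id', id_eq]
    linear_combination hc'
  obtain ⟨γ, hγ⟩ := (InfiniteGalois.mem_range_algebraMap_iff_fixed _).2 hfix
  refine ⟨γ, (algebraMap K Ω).injective ?_⟩
  rw [map_pow, hγ, map_pow, ← hP, mul_pow, ← pow_mul, ← pow_mul, ← pow_mul, mul_comm t,
    pow_mul ζ, hζ.pow_eq_one, one_pow, mul_one, mul_comm]

end KummerRoot

/-! ### Leading terms in a valued field -/

/-- Two elements of a valued field are near if they have the same leading term. -/
def Valuation.Near {Ω Γ₀ : Type*} [Field Ω] [LinearOrderedCommGroupWithZero Γ₀]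
    (v : Valuation Ω Γ₀) (x y : Ω) : Prop := v (x - y) < v x

namespace Valuation.Near

variable {Ω Γ₀ : Type*} [Field Ω] [LinearOrderedCommGroupWithZero Γ₀] {v : Valuation Ω Γ₀}
  {x y z : Ω}

theorem map_eq (h : v.Near x y) : v y = v x := by
  rw [Near, v.map_sub_swap] at h
  simpa using v.map_add_eq_of_lt_right h

theorem symm (h : v.Near x y) : v.Near y x := by
  rw [Near, h.map_eq, v.map_sub_swap]
  exact h

theorem trans (h : v.Near x y) (h' : v.Near y z) : v.Near x z := by
  have := v.map_add_lt h (h'.trans_eq h.map_eq)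
  rwa [sub_add_sub_cancel] at this

theorem pow (h : v.Near x y) (m : ℕ) : v.Near (x ^ m) (y ^ m) := by
  have hx : 0 < v x := lt_of_le_of_lt zero_le h
  rw [Near, map_pow]
  induction m with
  | zero => simp
  | succ m ih =>
    have : x ^ (m + 1) - y ^ (m + 1) = x ^ m * (x - y) + (x ^ m - y ^ m) * y := by ring
    rw [this, pow_succ]
    refine v.map_add_lt ?_ ?_
    · rw [map_mul, map_pow]
      exact mul_lt_mul_of_pos_left h (pow_pos hx m)
    · rw [map_mul, h.map_eq]
      exact mul_lt_mul_of_pos_right ih hx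

/-- Tameness: if the quotient `z = y / x` were not `1`, then `1 + z + ... + z ^ (m - 1) = 0`. Each
term is near `1`, so the sum differs from `m` by less than `1 = v m`, a contradiction. -/
theorem eq_of_pow_eq {m : ℕ} (hm : v m = 1) (h : v.Near x y) (hxy : x ^ m = y ^ m) : x = y := by
  have hx : 0 < v x := lt_of_le_of_lt zero_le h
  have hx0 : x ≠ 0 := by rintro rfl; simp at hx
  have h1 : v.Near 1 (y / x) := by
    rw [Near, one_sub_div hx0, map_div₀, map_one]
    exact (div_lt_one₀ hx).2 h
  have h2 : (y / x) ^ m = 1 := by rw [div_pow, hxy, div_self]; rw [← hxy]; exact pow_ne_zero _ hx0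
  have h3 := geom_sum_mul (y / x) m
  rw [h2, sub_self, mul_eq_zero, sub_eq_zero] at h3
  rcases h3 with h3 | h3
  · exfalso
    have h4 : v (∑ i ∈ Finset.range m, ((y / x) ^ i - 1)) < 1 := by
      refine v.map_sum_lt one_ne_zero fun i _ => ?_
      have := h1.symm.pow i
      rwa [one_pow, Near, map_pow, h1.map_eq, map_one, one_pow] at this
    rw [Finset.sum_sub_distrib, h3, zero_sub, v.map_neg] at h4
    simp [hm] at h4
  · exact ((div_eq_one_iff_eq hx0).1 h3).symm

end Valuation.Near

/-- The value `g(y)` is the product of the differences `y - x` over all roots `x`, so these cannot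
all have valuation at least `c`. -/
theorem Valuation.exists_mem_roots_map_sub_lt {Ω Γ₀ : Type*} [Field Ω] [IsAlgClosed Ω]
    [LinearOrderedCommGroupWithZero Γ₀] (v : Valuation Ω Γ₀) {g : Polynomial Ω} (hg : g.Monic)
    {y : Ω} {c : Γ₀} (h : v (g.eval y) < c ^ g.natDegree) : ∃ x ∈ g.roots, v (y - x) < c := by
  by_contra! hc
  refine h.not_ge ?_
  have hs := IsAlgClosed.splits g
  rw [hs.natDegree_eq_card_roots, hs.eval_eq_prod_roots_of_monic hg, map_multiset_prod,
    Multiset.map_map]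
  have : ∀ s : Multiset Ω, (∀ x ∈ s, c ≤ v (y - x)) →
      c ^ s.card ≤ (s.map (v ∘ fun x => y - x)).prod := by
    intro s
    induction s using Multiset.induction_on with
    | empty => simp
    | cons a s ih =>
      intro hs
      rw [Multiset.card_cons, pow_succ', Multiset.map_cons, Multiset.prod_cons]
      exact mul_le_mul' (hs a (Multiset.mem_cons_self a s))
        (ih fun x hx => hs x (Multiset.mem_cons_of_mem hx))
  exact this _ hc

/-! ### Iterates of `f` compared with powers outside the unit ball -/

section Escape

variable {K : Type*} [Field K] {Γ₀ : Type*} [LinearOrderedCommGroupWithZero Γ₀]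
  {f : Polynomial K} {Ω : Type*} [Field Ω] [Algebra K Ω] {v : Valuation Ω Γ₀}

/-- For `|x| > 1` and integral coefficients, the monic top term strictly dominates all the others.
-/
theorem near_pow_aeval (hf : f.Monic) (hc : ∀ i, v (algebraMap K Ω (f.coeff i)) ≤ 1) {x : Ω}
    (hx : 1 < v x) : v.Near (x ^ f.natDegree) (aeval x f) := by
  have hx0 : v x ≠ 0 := (zero_lt_one.trans hx).ne'
  rw [Valuation.Near, v.map_sub_swap, aeval_eq_sum_range, Finset.sum_range_succ,
    hf.coeff_natDegree, one_smul, add_sub_cancel_right, map_pow]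
  refine v.map_sum_lt (pow_ne_zero _ hx0) fun i hi => ?_
  rw [Algebra.smul_def, map_mul, map_pow]
  calc _ ≤ 1 * v x ^ i := mul_le_mul_left (hc i) _
    _ < v x ^ f.natDegree := by
      rw [one_mul]
      exact pow_lt_pow_right₀ hx (Finset.mem_range.1 hi)

theorem map_aeval_le_one (hc : ∀ i, v (algebraMap K Ω (f.coeff i)) ≤ 1) {x : Ω}
    (hx : v x ≤ 1) : v (aeval x f) ≤ 1 := by
  rw [aeval_eq_sum_range]
  refine v.map_sum_le fun i _ => ?_
  rw [Algebra.smul_def, map_mul, map_pow]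
  exact mul_le_one' (hc i) (pow_le_one' hx i)

theorem one_lt_map_aeval_iff (hf : f.Monic) (hd : f.natDegree ≠ 0)
    (hc : ∀ i, v (algebraMap K Ω (f.coeff i)) ≤ 1) {x : Ω} :
    1 < v (aeval x f) ↔ 1 < v x := by
  constructor
  · contrapose!
    exact map_aeval_le_one hc
  · intro hx
    rw [(near_pow_aeval hf hc hx).map_eq, map_pow]
    exact one_lt_pow' hx hd

theorem one_lt_map_iterate_aeval_iff (hf : f.Monic) (hd : f.natDegree ≠ 0)
    (hc : ∀ i, v (algebraMap K Ω (f.coeff i)) ≤ 1) {x : Ω} (N : ℕ) :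
    1 < v ((fun z => aeval z f)^[N] x) ↔ 1 < v x := by
  induction N generalizing x with
  | zero => rfl
  | succ N ih => rw [Function.iterate_succ_apply, ih, one_lt_map_aeval_iff hf hd hc]

theorem near_pow_iterate_aeval (hf : f.Monic) (hd : f.natDegree ≠ 0)
    (hc : ∀ i, v (algebraMap K Ω (f.coeff i)) ≤ 1) {x : Ω} (hx : 1 < v x) (N : ℕ) :
    v.Near (x ^ f.natDegree ^ N) ((fun z => aeval z f)^[N] x) := by
  induction N generalizing x with
  | zero =>
    rw [pow_zero, pow_one, Function.iterate_zero_apply, Valuation.Near, sub_self, map_zero]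
    exact zero_lt_one.trans hx
  | succ N ih =>
    rw [Function.iterate_succ_apply, pow_succ', pow_mul]
    exact ((near_pow_aeval hf hc hx).pow _).trans (ih ((one_lt_map_aeval_iff hf hd hc).2 hx))

/-- The polynomial whose roots are the nodes at level `N`. -/
noncomputable def nodePolynomial (Ω : Type*) [Field Ω] [Algebra K Ω] (f : Polynomial K) (P : K)
    (N : ℕ) : Polynomial Ω :=
  (f.map (algebraMap K Ω)).comp^[N] X - C (algebraMap K Ω P)

theorem eval_nodePolynomial (f : Polynomial K) (P : K) (N : ℕ) (x : Ω) :
    (nodePolynomial Ω f P N).eval x = (fun z => aeval z f)^[N] x - algebraMap K Ω P := by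
  rw [nodePolynomial, eval_sub, eval_C, iterate_comp_eval, eval_X]
  simp only [eval_map_algebraMap]

theorem natDegree_nodePolynomial (f : Polynomial K) (P : K) (N : ℕ) :
    (nodePolynomial Ω f P N).natDegree = f.natDegree ^ N := by
  rw [nodePolynomial, natDegree_sub_C, natDegree_iterate_comp, natDegree_X, mul_one,
    natDegree_map]

theorem monic_nodePolynomial (hf : f.Monic) (hd : f.natDegree ≠ 0) (P : K) (N : ℕ) :
    (nodePolynomial Ω f P N).Monic := by
  have hm : ((f.map (algebraMap K Ω)).comp^[N] X).Monic := by
    induction N with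
    | zero => exact monic_X
    | succ N ih =>
      rw [Function.iterate_succ_apply']
      refine (hf.map _).comp ih ?_
      rw [natDegree_iterate_comp, natDegree_X, mul_one, natDegree_map]
      exact pow_ne_zero _ hd
  refine hm.sub_of_left ?_
  refine degree_C_le.trans_lt (natDegree_pos_iff_degree_pos.1 ?_)
  rw [natDegree_iterate_comp, natDegree_X, mul_one, natDegree_map]
  exact pow_pos (Nat.pos_of_ne_zero hd) N

/-- Near every `d ^ N`-th root of `P` there is an `N`-th iterated preimage of `P`. -/
theorem exists_near_iterate_aeval_eq [IsAlgClosed Ω] (hf : f.Monic) (hd : f.natDegree ≠ 0)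
    (hc : ∀ i, v (algebraMap K Ω (f.coeff i)) ≤ 1) {P : K} {N : ℕ} {y : Ω} (hy : 1 < v y)
    (hyP : y ^ f.natDegree ^ N = algebraMap K Ω P) :
    ∃ x : Ω, (fun z => aeval z f)^[N] x = algebraMap K Ω P ∧ v.Near y x := by
  have hm := monic_nodePolynomial (Ω := Ω) hf hd P N
  obtain ⟨x, hx, hxy⟩ := v.exists_mem_roots_map_sub_lt hm (y := y) (c := v y) (by
    -- At `y` the node polynomial takes the value `f^N(y) - y ^ (d ^ N)`, which is smaller than `v
    -- y` to the power of its degree.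
    have := near_pow_iterate_aeval hf hd hc hy N
    rw [Valuation.Near, hyP, v.map_sub_swap, ← hyP, map_pow, hyP] at this
    rwa [eval_nodePolynomial, natDegree_nodePolynomial])
  refine ⟨x, ?_, hxy⟩
  rw [mem_roots hm.ne_zero, IsRoot.def, eval_nodePolynomial, sub_eq_zero] at hx
  exact hx

end Escape

/-! ### Compatible towers of roots of unity and of roots of `P` -/

theorem exists_primitiveRoot_tower (Ω : Type*) [Field Ω] [IsAlgClosed Ω] {d : ℕ}
    [NeZero (d : Ω)] :
    ∃ ζ : ℕ → Ω, ∀ N, IsPrimitiveRoot (ζ N) (d ^ N) ∧ ζ (N + 1) ^ d = ζ N := by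
  have hd : d ≠ 0 := fun h => NeZero.ne (d : Ω) (by simp [h])
  have step : ∀ (N : ℕ) (x : {x : Ω // IsPrimitiveRoot x (d ^ N)}),
      ∃ y : {y : Ω // IsPrimitiveRoot y (d ^ (N + 1))}, y.1 ^ d = x.1 := by
    rintro N ⟨x, hx⟩
    have : NeZero (d ^ N) := ⟨pow_ne_zero _ hd⟩
    have : NeZero ((d ^ (N + 1) : ℕ) : Ω) := ⟨by push_cast; exact pow_ne_zero _ (NeZero.ne _)⟩
    obtain ⟨z, hz⟩ := HasEnoughRootsOfUnity.exists_primitiveRoot Ω (d ^ (N + 1))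
    rcases N.eq_zero_or_pos with rfl | hN
    · refine ⟨⟨z, hz⟩, ?_⟩
      have h1 := hz.pow_eq_one
      rw [zero_add, pow_one] at h1
      rw [h1]
      exact (IsPrimitiveRoot.one_right_iff.1 (by simpa using hx)).symm
    · have hzd : IsPrimitiveRoot (z ^ d) (d ^ N) :=
        hz.pow (pow_pos (Nat.pos_of_ne_zero hd) _) (pow_succ' d N)
      obtain ⟨j, -, hj, hjx⟩ := hzd.isPrimitiveRoot_iff.1 hx
      refine ⟨⟨z ^ j, hz.pow_of_coprime j ?_⟩, ?_⟩
      · exact ((Nat.coprime_pow_right_iff hN _ _).1 hj).pow_right _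
      · exact (pow_right_comm z j d).trans hjx
  choose next hnext using step
  let ζ : ∀ N, {x : Ω // IsPrimitiveRoot x (d ^ N)} := fun N =>
    Nat.rec ⟨1, by simp⟩ next N
  exact ⟨fun N => (ζ N).1, fun N => ⟨(ζ N).2, hnext N (ζ N)⟩⟩

theorem exists_root_tower {Ω : Type*} [Field Ω] [IsAlgClosed Ω] {d : ℕ} (hd : d ≠ 0) (P : Ω) :
    ∃ β : ℕ → Ω, β 0 = P ∧ ∀ N, β (N + 1) ^ d = β N := by
  choose next hnext using fun x : Ω => IsAlgClosed.exists_pow_nat_eq x (Nat.pos_of_ne_zero hd)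
  exact ⟨fun N => Nat.rec P (fun _ => next) N, rfl, fun N => hnext _⟩

theorem root_tower_pow {Ω : Type*} [Field Ω] {d : ℕ} {P : Ω} {β : ℕ → Ω} (h0 : β 0 = P)
    (h : ∀ N, β (N + 1) ^ d = β N) (N : ℕ) : β N ^ d ^ N = P := by
  induction N with
  | zero => simpa using h0
  | succ N ih => rw [pow_succ', pow_mul, h, ih]

/-! ### Labelling the nodes by nearby roots, and closedness of the image -/

section Labelling

variable {K : Type*} [Field K] {Γ₀ : Type*} [LinearOrderedCommGroupWithZero Γ₀]
  {f : Polynomial K} {v : Valuation (AlgebraicClosure K) Γ₀}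

theorem exists_node_equiv_near (hf : f.Monic) (hd : f.natDegree ≠ 0)
    (hc : ∀ i, v (algebraMap K _ (f.coeff i)) ≤ 1) (hvd : v f.natDegree = 1) {P : K}
    (hP : 1 < v (algebraMap K _ P)) {N : ℕ} {ζ β : AlgebraicClosure K}
    (hζ : IsPrimitiveRoot ζ (f.natDegree ^ N)) (hβ : β ^ f.natDegree ^ N = algebraMap K _ P) :
    ∃ α : ZMod (f.natDegree ^ N) ≃ (preimageTree f P).node N,
      ∀ k x, v.Near (kummerRoot _ ζ β k) x.1 ↔ x = α k := by
  classical
  have : NeZero (f.natDegree ^ N) := ⟨pow_ne_zero _ hd⟩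
  have hn : v ((f.natDegree ^ N : ℕ) : AlgebraicClosure K) = 1 := by
    rw [Nat.cast_pow, map_pow, hvd, one_pow]
  have hβ0 : β ≠ 0 := by
    rintro rfl
    rw [zero_pow (NeZero.ne _)] at hβ
    rw [← hβ, map_zero] at hP
    exact not_lt_zero hP
  have hpow : ∀ k, kummerRoot _ ζ β k ^ f.natDegree ^ N = algebraMap K _ P :=
    fun k => (kummerRoot_pow hζ k).trans hβ
  have hlt : ∀ k : ZMod (f.natDegree ^ N), 1 < v (kummerRoot _ ζ β k) := by
    intro k
    rw [← hpow k, map_pow] at hP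
    by_contra! h
    exact hP.not_ge (pow_le_one' h _)
  choose x hx hxn using fun k => exists_near_iterate_aeval_eq hf hd hc (hlt k) (hpow k)
  have huniq : ∀ k l z, v.Near (kummerRoot _ ζ β k) z → v.Near (kummerRoot _ ζ β l) z → k = l :=
    fun k l z h1 h2 => kummerRoot_injective hζ hβ0
      ((h1.trans h2.symm).eq_of_pow_eq hn ((hpow k).trans (hpow l).symm))
  let φ : ZMod (f.natDegree ^ N) → (preimageTree f P).node N := fun k => ⟨x k, hx k⟩
  have hφ : Function.Injective φ := by
    intro k l h
    have h' : x k = x l := congrArg Subtype.val h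
    exact huniq k l (x k) (hxn k) (h' ▸ hxn l)
  have hm := monic_nodePolynomial (Ω := AlgebraicClosure K) hf hd P N
  let ψ : (preimageTree f P).node N → (nodePolynomial (AlgebraicClosure K) f P N).roots.toFinset :=
    fun z => ⟨z.1, by
      rw [Multiset.mem_toFinset, mem_roots hm.ne_zero, IsRoot.def, eval_nodePolynomial,
        sub_eq_zero]
      exact z.2⟩
  have hψ : Function.Injective ψ := by
    intro z w h
    have h' : (ψ z).1 = (ψ w).1 := congrArg Subtype.val h
    exact Subtype.ext h'
  have : Finite ((preimageTree f P).node N) := Finite.of_injective ψ hψ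
  -- The nodes are roots of a polynomial of degree `d ^ N`, so the injection `φ` from `d ^ N` labels
  -- is bijective.
  have hcard : Nat.card ((preimageTree f P).node N) ≤ Nat.card (ZMod (f.natDegree ^ N)) := by
    refine (Nat.card_le_card_of_injective ψ hψ).trans ?_
    rw [Nat.card_zmod, ← natDegree_nodePolynomial (Ω := AlgebraicClosure K) f P N]
    simp only [Nat.card_eq_fintype_card, Fintype.card_coe]
    exact (Multiset.toFinset_card_le _).trans (card_roots' _)
  have hbij : Function.Bijective φ := hφ.bijective_of_nat_card_le hcard
  refine ⟨Equiv.ofBijective φ hbij, fun k z => ⟨fun h => ?_, ?_⟩⟩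
  · obtain ⟨l, rfl⟩ := hbij.2 z
    rw [huniq k l _ h (hxn l)]
    rfl
  · rintro rfl
    exact hxn k

/-- Outside the filled Julia set, the tree of iterated preimages has a consistent labelling for
which each node is near the point with the same label in the tree of iterated `d`-th roots. -/
theorem exists_consistentLabelling_near (hf : f.Monic) (hd : f.natDegree ≠ 0)
    (hc : ∀ i, v (algebraMap K _ (f.coeff i)) ≤ 1) (hvd : v f.natDegree = 1) {P : K}
    (hP : 1 < v (algebraMap K _ P)) {ζ β : ℕ → AlgebraicClosure K}
    (hζ : ∀ N, IsPrimitiveRoot (ζ N) (f.natDegree ^ N) ∧ ζ (N + 1) ^ f.natDegree = ζ N)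
    (hβ0 : β 0 = algebraMap K _ P) (hβ : ∀ N, β (N + 1) ^ f.natDegree = β N) :
    ∃ L : (preimageTree f P).ConsistentLabelling f.natDegree,
      ∀ N k x, v.Near (kummerRoot _ (ζ N) (β N) k) x.1 ↔ x = L.α N k := by
  choose α hα using fun N => exists_node_equiv_near hf hd hc hvd hP (hζ N).1
    (root_tower_pow hβ0 hβ N)
  refine ⟨⟨α, fun N k => ?_⟩, hα⟩
  have : NeZero (f.natDegree ^ N) := ⟨pow_ne_zero _ hd⟩
  have : NeZero (f.natDegree ^ (N + 1)) := ⟨pow_ne_zero _ hd⟩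
  rw [← hα]
  have h1 := (hα (N + 1) k _).2 rfl
  have h2 : 1 < v (α (N + 1) k).1 := by
    rw [← one_lt_map_iterate_aeval_iff hf hd hc (N + 1), (α (N + 1) k).2]
    exact hP
  have h3 := (h1.pow f.natDegree).trans (near_pow_aeval hf hc h2)
  have h4 : kummerRoot _ (ζ (N + 1)) (β (N + 1)) k ^ f.natDegree =
      kummerRoot _ (ζ N) (β N)
        (ZMod.castHom (pow_dvd_pow f.natDegree (Nat.le_succ N)) (ZMod (f.natDegree ^ N)) k) := by
    rw [ZMod.castHom_apply, ZMod.cast_eq_val, kummerRoot_natCast (hζ N).1, kummerRoot, mul_pow,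
      pow_right_comm, (hζ N).2, hβ]
  rw [h4] at h3
  exact h3

theorem galoisPerm_label {P : K} (hv : ∀ (σ : Gal(AlgebraicClosure K/K)) x, v (σ x) = v x)
    {N n : ℕ} {ζ β : AlgebraicClosure K} {α : ZMod n ≃ (preimageTree f P).node N}
    (hα : ∀ k x, v.Near (kummerRoot n ζ β k) x.1 ↔ x = α k) (σ : Gal(AlgebraicClosure K/K))
    {k l : ZMod n} (h : σ (kummerRoot n ζ β k) = kummerRoot n ζ β l) :
    galoisPerm f P N σ (α k) = α l := by
  rw [← hα, ← h]
  change v (σ (kummerRoot n ζ β k) - σ (α k).1) < _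
  rw [← map_sub, hv, hv]
  exact (hα k _).2 rfl

/-- The image of the arboreal Galois representation is closed. -/
theorem mem_range_arborealRep [CharZero K] {P : K} (hsurj : ∀ N, Function.Surjective ((preimageTree f P).parent N)) (g : (preimageTree f P).Aut)
    (hg : ∀ N, ∃ σ, (arborealRep f P σ).1 N = g.1 N) : g ∈ (arborealRep f P).range := by
  let S : ℕ → Set Gal(AlgebraicClosure K/K) := fun N => {σ | galoisPerm f P N σ = g.1 N}
  have hopen : ∀ x y : AlgebraicClosure K, IsOpen {σ : Gal(AlgebraicClosure K/K) | σ x = y} := by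
    intro x y
    rw [isOpen_iff_mem_nhds]
    rintro τ rfl
    have h := (stabilizer_isOpen_of_isIntegral (K := K) x).preimage (continuous_const_mul τ⁻¹)
    refine Filter.mem_of_superset (h.mem_nhds (by simp)) fun σ hσ => ?_
    have h2 : τ⁻¹ (σ x) = x := hσ
    change σ x = τ x
    conv_rhs => rw [← h2]
    exact (τ.apply_symm_apply (σ x)).symm
  have hclosed : ∀ N, IsClosed (S N) := by
    intro N
    have : S N = ⋂ x : (preimageTree f P).node N, {σ | σ x.1 = (g.1 N x).1} := by
      ext σ
      simp only [S, Set.mem_ofPred_eq, Set.mem_iInter, Equiv.ext_iff]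
      exact forall_congr' fun x => Subtype.ext_iff
    rw [this]
    refine isClosed_iInter fun x => ?_
    rw [← isOpen_compl_iff]
    have : {σ : Gal(AlgebraicClosure K/K) | σ x.1 = (g.1 N x).1}ᶜ =
        ⋃ y : {y // y ≠ (g.1 N x).1}, {σ | σ x.1 = y.1} := by
      ext σ
      simp
    rw [this]
    exact isOpen_iUnion fun y => hopen _ _
  have hne : (⋂ N, S N).Nonempty := by
    refine IsCompact.nonempty_iInter_of_sequence_nonempty_isCompact_isClosed S ?_
      (fun N => hg N) (hclosed 0).isCompact hclosed
    intro N σ hσ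
    -- The sets `S N` are nested: a permutation of level `N + 1` determines the one of level `N`,
    -- since every node has a node above it.
    refine Equiv.ext fun x => ?_
    obtain ⟨y, rfl⟩ := hsurj N x
    rw [← g.2, ← hσ]
    exact ((arborealRep f P σ).2 N y).symm
  obtain ⟨σ, hσ⟩ := hne
  exact ⟨σ, Subtype.ext (funext fun N => Set.mem_iInter.1 hσ N)⟩

end Labelling

/-! ### Residue ring and Frobenius elements -/

/-- The closed unit ball of an ultrametric normed field, as a subring. -/
def unitBall (K : Type*) [NormedField K] [IsUltrametricDist K] : Subring K where
  carrier := {x | ‖x‖ ≤ 1}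
  mul_mem' {x y} hx hy := by
    change ‖x * y‖ ≤ 1
    rw [norm_mul]
    exact mul_le_one₀ hx (norm_nonneg y) hy
  one_mem' := norm_one.le
  add_mem' {x y} hx hy := (IsUltrametricDist.norm_add_le_max x y).trans (max_le hx hy)
  zero_mem' := by
    change ‖(0 : K)‖ ≤ 1
    simp
  neg_mem' {x} hx := (norm_neg x).trans_le hx

/-- The open unit ball of an ultrametric normed field, as an ideal of the closed unit ball. -/
def openUnitBall (K : Type*) [NormedField K] [IsUltrametricDist K] : Ideal (unitBall K) where
  carrier := {x | ‖x.1‖ < 1}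
  add_mem' {x y} hx hy := (IsUltrametricDist.norm_add_le_max x.1 y.1).trans_lt (max_lt hx hy)
  zero_mem' := by
    change ‖(0 : K)‖ < 1
    simp
  smul_mem' c x hx := by
    change ‖c.1 * x.1‖ < 1
    rw [norm_mul]
    exact mul_lt_one_of_nonneg_of_lt_one_right c.2 (norm_nonneg _) hx

section UnitBall

variable {K : Type*} [NormedField K] [IsUltrametricDist K]

theorem mem_unitBall {x : K} : x ∈ unitBall K ↔ ‖x‖ ≤ 1 := Iff.rfl

theorem mem_openUnitBall {x : unitBall K} : x ∈ openUnitBall K ↔ ‖x.1‖ < 1 := Iff.rfl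

instance openUnitBall_isPrime : (openUnitBall K).IsPrime := by
  refine Ideal.isPrime_iff.2 ⟨?_, ?_⟩
  · rw [Ideal.ne_top_iff_one, mem_openUnitBall]
    simp
  · intro x y h
    rw [mem_openUnitBall, mem_openUnitBall]
    by_contra! hc
    rw [mem_openUnitBall] at h
    refine h.not_ge ?_
    change 1 ≤ ‖x.1 * y.1‖
    rw [norm_mul]
    exact one_le_mul_of_one_le_of_one_le hc.1 hc.2

instance finite_quotient_openUnitBall [ProperSpace K] : Finite (unitBall K ⧸ openUnitBall K) := by
  have hb : IsCompact (unitBall K : Set K) := by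
    convert isCompact_closedBall (0 : K) 1
    ext x
    simp [mem_unitBall]
  have : CompactSpace (unitBall K) := isCompact_iff_compactSpace.1 hb
  have ho : IsOpen ((openUnitBall K).toAddSubgroup : Set (unitBall K)) := by
    have : ((openUnitBall K).toAddSubgroup : Set (unitBall K)) =
        (fun x : unitBall K => ‖x.1‖) ⁻¹' Set.Iio 1 := rfl
    rw [this]
    exact isOpen_Iio.preimage (continuous_norm.comp continuous_subtype_val)
  exact AddSubgroup.quotient_finite_of_isOpen _ ho

theorem one_lt_card_quotient_openUnitBall [ProperSpace K] :
    1 < Nat.card (unitBall K ⧸ openUnitBall K) :=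
  have : Nontrivial (unitBall K ⧸ openUnitBall K) :=
    Ideal.Quotient.nontrivial_iff.2 openUnitBall_isPrime.ne_top
  Finite.one_lt_card

variable {L : Type*} [NormedField L] [NormedAlgebra K L] [IsUltrametricDist L]

instance unitBallAlgebra : Algebra (unitBall K) (unitBall L) :=
  ((algebraMap K L).restrict (unitBall K) (unitBall L) fun x hx => by
    rw [mem_unitBall, norm_algebraMap']
    exact hx).toAlgebra

theorem coe_algebraMap_unitBall (x : unitBall K) :
    ((algebraMap (unitBall K) (unitBall L) x : unitBall L) : L) = algebraMap K L x.1 := rfl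

theorem openUnitBall_under : (openUnitBall L).under (unitBall K) = openUnitBall K := by
  ext x
  rw [Ideal.under_def, Ideal.mem_comap, mem_openUnitBall, mem_openUnitBall,
    coe_algebraMap_unitBall, norm_algebraMap']

/-- Existence of Frobenius elements, in their action on roots of unity of order prime to the
residue characteristic. -/
theorem exists_galois_apply_eq_pow_card_residue [ProperSpace L] [FiniteDimensional K L]
    [IsGalois K L] (hL : ∀ (σ : Gal(L/K)) x, ‖σ x‖ = ‖x‖) {m : ℕ} (hm : ‖(m : L)‖ = 1) {ζ : L}
    (hζ : ζ ^ m = 1) :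
    ∃ σ : Gal(L/K), σ ζ = ζ ^ Nat.card (unitBall K ⧸ openUnitBall K) := by
  let : MulSemiringAction Gal(L/K) (unitBall L) :=
    { smul := fun σ x => ⟨σ x.1, (hL σ x.1).trans_le x.2⟩
      one_smul := fun _ => rfl
      mul_smul := fun _ _ _ => rfl
      smul_zero := fun σ => Subtype.ext (map_zero σ)
      smul_add := fun σ x y => Subtype.ext (map_add σ x.1 y.1)
      smul_one := fun σ => Subtype.ext (map_one σ)
      smul_mul := fun σ x y => Subtype.ext (map_mul σ x.1 y.1) }
  have hsmul : ∀ (σ : Gal(L/K)) (x : unitBall L), (σ • x).1 = σ x.1 := fun _ _ => rfl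
  have : SMulCommClass Gal(L/K) (unitBall K) (unitBall L) := ⟨fun σ a x => by
    refine Subtype.ext ?_
    rw [Algebra.smul_def, Algebra.smul_def, hsmul]
    change σ (algebraMap K L a.1 * x.1) = algebraMap K L a.1 * σ x.1
    rw [map_mul, σ.commutes]⟩
  have : Algebra.IsInvariant (unitBall K) (unitBall L) Gal(L/K) := ⟨fun b hb => by
    obtain ⟨a, ha⟩ := (InfiniteGalois.mem_range_algebraMap_iff_fixed b.1).2
      fun σ => congrArg Subtype.val (hb σ)
    refine ⟨⟨a, ?_⟩, Subtype.ext ha⟩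
    rw [mem_unitBall, ← norm_algebraMap' L, ha]
    exact b.2⟩
  obtain ⟨σ, hσ⟩ := IsArithFrobAt.exists_of_isInvariant (unitBall K) Gal(L/K) (openUnitBall L)
  have hm0 : m ≠ 0 := by
    rintro rfl
    simp at hm
  have hζ1 : ‖ζ‖ = 1 := by
    rw [← pow_eq_one_iff_of_nonneg (norm_nonneg ζ) hm0, ← norm_pow, hζ, norm_one]
  have := hσ.apply_of_pow_eq_one (ζ := ⟨ζ, hζ1.le⟩) (m := m) (Subtype.ext hζ) (by
    rw [mem_openUnitBall]
    simp [hm])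
  rw [openUnitBall_under] at this
  exact ⟨σ, congrArg Subtype.val this⟩

end UnitBall

section Complete

variable (K : Type*) [NontriviallyNormedField K] [IsUltrametricDist K] [CompleteSpace K]

theorem exists_galois_invariant_valuation :
    ∃ v : Valuation (AlgebraicClosure K) ℝ≥0,
      (∀ x : K, v (algebraMap K _ x) = ‖x‖₊) ∧
      ∀ (σ : Gal(AlgebraicClosure K/K)) x, v (σ x) = v x := by
  let := spectralNorm.normedField K (AlgebraicClosure K)
  have : IsUltrametricDist (AlgebraicClosure K) :=
    IsUltrametricDist.isUltrametricDist_of_isNonarchimedean_norm isNonarchimedean_spectralNorm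
  refine ⟨NormedField.valuation, fun x => NNReal.eq ?_, fun σ x => NNReal.eq ?_⟩
  · exact spectralNorm_extends x
  · exact (spectralNorm_eq_of_equiv σ x).symm

/-- Frobenius is found in a finite Galois extension containing `ζ`, where the Galois group and the
residue ring are finite, and is then lifted to the algebraic closure. -/
theorem exists_galois_algebraicClosure_apply_eq_pow [ProperSpace K] [CharZero K] {m : ℕ}
    (hm : ‖(m : K)‖ = 1) {ζ : AlgebraicClosure K} (hζ : ζ ^ m = 1) :
    ∃ σ : Gal(AlgebraicClosure K/K), σ ζ = ζ ^ Nat.card (unitBall K ⧸ openUnitBall K) := by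
  let E := (FiniteGaloisIntermediateField.adjoin K {ζ}).toIntermediateField
  have hE : ζ ∈ E := FiniteGaloisIntermediateField.subset_adjoin K {ζ} rfl
  have : IsGalois K E := (FiniteGaloisIntermediateField.adjoin K {ζ}).isGalois
  have : FiniteDimensional K E := (FiniteGaloisIntermediateField.adjoin K {ζ}).finiteDimensional
  let := spectralNorm.normedField K E
  let := spectralNorm.normedAlgebra K E
  have : IsUltrametricDist E :=
    IsUltrametricDist.isUltrametricDist_of_isNonarchimedean_norm isNonarchimedean_spectralNorm
  have : ProperSpace E := FiniteDimensional.proper K E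
  obtain ⟨τ, hτ⟩ := exists_galois_apply_eq_pow_card_residue (K := K) (L := E)
    (fun σ x => (spectralNorm_eq_of_equiv σ x).symm) (m := m) (ζ := ⟨ζ, hE⟩)
    (by rw [← map_natCast (algebraMap K E), norm_algebraMap', hm]) (Subtype.ext hζ)
  refine ⟨τ.liftNormal (AlgebraicClosure K), ?_⟩
  have := AlgEquiv.liftNormal_commutes τ (AlgebraicClosure K) ⟨ζ, hE⟩
  rw [hτ] at this
  exact this

end Complete

/-! ### Discreteness of the value group, and the conclusion -/

/-- The value group of a finite extension of `ℚ_p` is discrete. -/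
theorem exists_norm_pow_eq_zpow (p : ℕ) [Fact p.Prime] (K : Type*) [NormedField K]
    [NormedAlgebra ℚ_[p] K] [FiniteDimensional ℚ_[p] K] {x : K} (hx : x ≠ 0) :
    ∃ s : ℤ, ‖x‖ ^ Module.finrank ℚ_[p] K = (p : ℝ) ^ s := by
  have hint : IsIntegral ℚ_[p] x := Algebra.IsIntegral.isIntegral x
  obtain ⟨e, he⟩ := minpoly.degree_dvd hint
  have hdeg : ((minpoly ℚ_[p] x).natDegree : ℝ) ≠ 0 := by
    exact_mod_cast (minpoly.natDegree_pos hint).ne'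
  have hc : (minpoly ℚ_[p] x).coeff 0 ≠ 0 := by
    rwa [Ne, minpoly.coeff_zero_eq_zero hint]
  -- The norm of `x` to the degree of its minimal polynomial is the norm of the constant
  -- coefficient, an integral power of `p`; that degree divides `[K : ℚ_p]`.
  rw [NormedAlgebra.norm_eq_spectralNorm ℚ_[p] x, spectralNorm.spectralNorm_eq_norm_coeff_zero_rpow,
    he, pow_mul, ← Real.rpow_natCast (_ ^ (_ : ℝ)) (minpoly ℚ_[p] x).natDegree,
    ← Real.rpow_mul (norm_nonneg _), one_div, inv_mul_cancel₀ hdeg, Real.rpow_one,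
    Padic.norm_eq_zpow_neg_valuation hc, ← zpow_natCast, ← zpow_mul]
  exact ⟨_, rfl⟩

theorem one_lt_norm_of_notMem_filledJulia {K : Type*} [NormedField K] [IsUltrametricDist K]
    {f : Polynomial K} (hgood : HasGoodReduction f) {P : K} (hP : P ∉ filledJulia f) :
    1 < ‖P‖ := by
  by_contra! h
  refine hP ((isBounded_iff_forall_norm_le).2 ⟨1, ?_⟩)
  rintro _ ⟨n, rfl⟩
  change ‖(fun w => f.eval w)^[n] P‖ ≤ 1
  induction n generalizing P with
  | zero => exact h
  | succ n ih =>
    refine ih (P := f.eval P) (fun h' => hP ?_) ?_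
    · refine (Bornology.isBounded_singleton (x := P)).union h' |>.subset ?_
      rintro _ ⟨m, rfl⟩
      rcases m with _ | m
      · exact Or.inl rfl
      · exact Or.inr ⟨m, rfl⟩
    · have hv := map_aeval_le_one (Ω := K) (v := NormedField.valuation (K := K)) (f := f)
        (fun i => hgood i) (x := P) h
      rw [coe_aeval_eq_eval] at hv
      exact hv

/-- Raising norms to the power `D` turns `γ ^ n = P ^ e` into an equality of integral powers of `p`;
compare exponents. -/
theorem dvd_mul_of_pow_eq_pow {p : ℕ} (hp : 1 < p) {K : Type*} [NormedField K] {D : ℕ}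
    (hD : ∀ x : K, x ≠ 0 → ∃ s : ℤ, ‖x‖ ^ D = (p : ℝ) ^ s) {P : K} {m : ℕ}
    (hP : ‖P‖ ^ D = (p : ℝ) ^ m) (hP0 : P ≠ 0) {γ : K} {n e : ℕ} (hn : n ≠ 0)
    (hγ : γ ^ n = P ^ e) : n ∣ m * e := by
  have hγ0 : γ ≠ 0 := by
    rintro rfl
    rw [zero_pow hn] at hγ
    exact pow_ne_zero e hP0 hγ.symm
  obtain ⟨s, hs⟩ := hD γ hγ0
  have hp0 : (0 : ℝ) < p := by exact_mod_cast zero_lt_one.trans hp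
  have hp1 : (p : ℝ) ≠ 1 := by exact_mod_cast hp.ne'
  have h : (p : ℝ) ^ (s * n) = (p : ℝ) ^ ((m * e : ℕ) : ℤ) := by
    rw [zpow_mul, ← hs, zpow_natCast, zpow_natCast, pow_mul, ← hP, pow_right_comm, ← norm_pow,
      hγ, norm_pow, pow_right_comm]
  have h2 := zpow_right_injective₀ hp0 hp1 h
  exact Int.natCast_dvd_natCast.1 ⟨s, by rw [← h2, mul_comm]⟩

theorem theorem1 (p : ℕ) [Fact p.Prime] (K : Type*) [NormedField K] [NormedAlgebra ℚ_[p] K]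
    [FiniteDimensional ℚ_[p] K] (f : Polynomial K) (hmonic : f.Monic)
    (hgood : HasGoodReduction f) (hdeg : ¬ p ∣ f.natDegree) (P : K) (hP : P ∉ filledJulia f) :
    ∃ G : Subgroup (preimageTree f P).Aut,
      (preimageTree f P).IsKummerSubgroup f.natDegree G ∧
      (arborealRep f P).range ≤ G ∧
      ((arborealRep f P).range.subgroupOf G).FiniteIndex := by
  have : IsUltrametricDist K := IsUltrametricDist.of_normedAlgebra ℚ_[p]
  have hP1 := one_lt_norm_of_notMem_filledJulia hgood hP
  let : NontriviallyNormedField K := { ‹NormedField K› with non_trivial := ⟨P, hP1⟩ }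
  have : ProperSpace K := FiniteDimensional.proper ℚ_[p] K
  have : CharZero K := charZero_of_injective_algebraMap (algebraMap ℚ_[p] K).injective
  have hd : f.natDegree ≠ 0 := fun h => hdeg (h ▸ dvd_zero p)
  have hdn : ‖(f.natDegree : K)‖ = 1 := by
    rw [← map_natCast (algebraMap ℚ_[p] K), norm_algebraMap', Padic.norm_natCast_eq_one_iff]
    exact (Nat.Prime.coprime_iff_not_dvd Fact.out).2 hdeg
  have hP0 : P ≠ 0 := by
    rintro rfl
    rw [norm_zero] at hP1
    exact hP1.not_ge zero_le_one
  obtain ⟨v, hvK, hvσ⟩ := exists_galois_invariant_valuation K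
  have hc : ∀ i, v (algebraMap K _ (f.coeff i)) ≤ 1 := fun i => (hvK _).trans_le (hgood i)
  have hvd : v f.natDegree = 1 := by
    rw [← map_natCast (algebraMap K (AlgebraicClosure K)), hvK]
    exact NNReal.eq hdn
  have hvP : 1 < v (algebraMap K _ P) := by
    rw [hvK]
    exact hP1
  have : NeZero (f.natDegree : AlgebraicClosure K) := ⟨Nat.cast_ne_zero.2 hd⟩
  obtain ⟨ζ, hζ⟩ := exists_primitiveRoot_tower (AlgebraicClosure K) (d := f.natDegree)
  obtain ⟨β, hβ0, hβ⟩ := exists_root_tower hd (algebraMap K (AlgebraicClosure K) P)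
  have hβP := root_tower_pow hβ0 hβ
  have hβne : ∀ N, β N ≠ 0 := by
    intro N h
    have := hβP N
    rw [h, zero_pow (pow_ne_zero _ hd)] at this
    exact hP0 ((map_eq_zero _).1 this.symm)
  obtain ⟨L, hL⟩ := exists_consistentLabelling_near hmonic hd hc hvd hvP hζ hβ0 hβ
  have hne : ∀ N, NeZero (f.natDegree ^ N) := fun N => ⟨pow_ne_zero _ hd⟩
  have haff : ∀ (σ : Gal(AlgebraicClosure K/K)) N, ∃ a : AffineZMod (f.natDegree ^ N),
      (∀ k, σ (kummerRoot _ (ζ N) (β N) k) = kummerRoot _ (ζ N) (β N) (affinePerm _ a k)) ∧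
      L.affine N a = (arborealRep f P σ).1 N := by
    intro σ N
    have := hne N
    obtain ⟨a, ha⟩ := exists_map_kummerRoot_eq (σ := (σ : AlgebraicClosure K →+* _)) (hζ N).1
      (hβne N) (by rw [hβP]; exact σ.commutes P)
    exact ⟨a, ha, ((L.eq_affine_iff N _ a).2 fun k => galoisPerm_label hvσ (hL N) σ (ha k)).symm⟩
  have hle : (arborealRep f P).range ≤ L.affineGroup := by
    rintro _ ⟨σ, rfl⟩
    exact L.mem_affineGroup.2 fun N => ⟨_, (haff σ N).choose_spec.2⟩
  refine ⟨L.affineGroup, L.isKummerSubgroup_affineGroup hd, hle, ?_⟩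
  let ρ : Gal(AlgebraicClosure K/K) →* L.affineGroup :=
    (arborealRep f P).codRestrict L.affineGroup fun σ => hle ⟨σ, rfl⟩
  let r : ∀ N, Gal(AlgebraicClosure K/K) →* AffineZMod (f.natDegree ^ N) :=
    fun N => (L.affinePart N).comp ρ
  have hr : ∀ N σ k, σ (kummerRoot _ (ζ N) (β N) k) =
      kummerRoot _ (ζ N) (β N) (affinePerm _ (r N σ) k) := by
    intro N σ
    obtain ⟨a, ha, ha'⟩ := haff σ N
    have : r N σ = a := L.affine_injective N ((L.affine_affinePart N (ρ σ)).trans ha'.symm)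
    rw [this]
    exact ha
  have hrange : ∀ N, (((arborealRep f P).range.subgroupOf L.affineGroup).map (L.affinePart N)) =
      (r N).range := by
    intro N
    have : (arborealRep f P).range.subgroupOf L.affineGroup = ρ.range := by
      ext g
      simp only [Subgroup.mem_subgroupOf, MonoidHom.mem_range, Subtype.ext_iff]
      rfl
    rw [this, MonoidHom.map_range]
  set q := Nat.card (unitBall K ⧸ openUnitBall K) with hq
  have hq1 : 1 < q := one_lt_card_quotient_openUnitBall
  have hfrob : ∀ N, ∃ σ, ((r N σ).right : ZMod (f.natDegree ^ N)) = q := by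
    intro N
    have := hne N
    obtain ⟨σ, hσ⟩ := exists_galois_algebraicClosure_apply_eq_pow K (m := f.natDegree ^ N)
      (by rw [Nat.cast_pow, norm_pow, hdn, one_pow]) (hζ N).1.pow_eq_one
    refine ⟨σ, ?_⟩
    rw [map_root_of_unity_eq_pow (hζ N).1 (hβne N) (hr N σ),
      (hζ N).1.pow_eq_pow_iff_natCast_eq] at hσ
    simpa using hσ
  -- At level `1`, `q` is the linear part of an affine map, hence a unit modulo `d`.
  have hqd : q.Coprime f.natDegree := by
    obtain ⟨σ, hσ⟩ := hfrob 1
    have h := (r 1 σ).right.isUnit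
    rw [hσ, ZMod.isUnit_iff_coprime, pow_one] at h
    exact h
  obtain ⟨c₂, hc₂, hc₂'⟩ := exists_pow_dvd_mul_orderOf hd hq1 hqd
  have hp1 : 1 < p := (Fact.out : p.Prime).one_lt
  have hp1' : (1 : ℝ) < p := by exact_mod_cast hp1
  obtain ⟨m, hm0, hm⟩ : ∃ m : ℕ, m ≠ 0 ∧ ‖P‖ ^ Module.finrank ℚ_[p] K = (p : ℝ) ^ m := by
    obtain ⟨s, hs⟩ := exists_norm_pow_eq_zpow p K hP0
    have h1 := one_lt_pow₀ hP1 (Module.finrank_pos (R := ℚ_[p]) (M := K)).ne'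
    rw [hs, one_lt_zpow_iff_right₀ hp1'] at h1
    lift s to ℕ using h1.le
    exact ⟨s, by omega, by rw [hs, zpow_natCast]⟩
  -- The factor `m * (q - 1)` bounds the loss in translations, where `m` is the exponent of `p` in
  -- the power of `‖P‖`; `c₂` bounds the loss in the order of Frobenius.
  refine L.finiteIndex_subgroupOf_affineGroup hd _ (fun g hg => ?_) (m * (q - 1) * c₂)
    fun N => ?_
  · refine mem_range_arborealRep (fun N => L.parent_surjective hd N) g fun N => ?_
    obtain ⟨_, ⟨σ, rfl⟩, hσ⟩ := hg N
    exact ⟨σ, hσ⟩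
  · have := hne N
    rw [hrange]
    obtain ⟨σ, hσ⟩ := hfrob N
    obtain ⟨γ, hγ⟩ := exists_pow_eq_pow_card_translations (hζ N).1 (hβne N) (hβP N) (r N) (hr N)
      hq1.le hσ
    refine AffineZMod.index_le (MonoidHom.mem_range.2 ⟨σ, rfl⟩) (mul_ne_zero hm0 (by omega)) hc₂ ?_ (hc₂' N _ hσ)
    have := dvd_mul_of_pow_eq_pow hp1 (fun x hx => exists_norm_pow_eq_zpow p K hx) hm hP0
      (NeZero.ne _) hγ
    rwa [mul_assoc, mul_comm (q - 1)]
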